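/- **Setting.** For a complex Schwartz function $f$ on $\mathbb R$ (time) put $\hat f(\omega)=\int f(t)e^{i\omega t}\,dt$ and $f_t(s)=f(s+t)$. Let $\nu$ be a positive Borel measure of at most polynomial growth on $\mathbb R$ with $\nu((-\infty,0))=0$ (for a spectral density $\rho$, $d\nu=\Theta(\omega)\rho(\omega^2)\,d\omega$; discrete measures are allowed), and put $\langle f|g\rangle_\nu=\int \overline{\hat f(\omega)}\,\hat g(\omega)\,d\nu(\omega)$. Let $V$ be a translation-invariant real-linear space of complex Schwartz functions (for instance all of them, or all real-valued ones), and let $\mathcal A$ be the unital complex $*$-algebra of polynomials in Hermitian symbols $\varphi(f)$, $f\in V$. Let $\psi$ be an arbitrary quasi-free state of the generalized free field with spectral measure $\nu$: a normalised positive linear functional on $\mathcal A$ for which there is a real-bilinear $w:V\times V\to\mathbb C$ such that all $\psi(\varphi(f_1)\cdots\varphi(f_n))$ are given by Wick's theorem (the sum over all pairings of $\{1,\dots,n\}$ of the products of $w(f_i,f_j)$ over the pairs $i<j$, which is zero for odd $n$), and $$\psi([\varphi(f),\varphi(g)])=2i\,\mathrm{Im}\,\langle f|g\rangle_\nu\qquad(f,g\in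 V).$$ The symmetric part of $w$ is otherwise arbitrary; in particular $\psi$ need not be invariant under time translations. Represent $\psi$ in its GNS Hilbert space by the vector $|1\rangle_\psi$, with $\varphi(f)$ acting on the dense invariant domain $\{|a\rangle_\psi:a\in\mathcal A\}$ by $\varphi(f)|a\rangle_\psi=|\varphi(f)a\rangle_\psi$. For an operator $T$ on this domain let $\|T\|_\infty\in[0,\infty]$ be the supremum of $\|Tx\|$ over the vectors $x$ of the domain with $\|x\|\le 1$, and for a commutator $C$ of two field operators let $|C|^{2k}=(C^\dagger C)^k$. **Theorem.** In the GNS representation the field commutator is a multiple of the identity: $[\varphi(f),\varphi(g)]=2i\,\mathrm{Im}\,\langle f|g\rangle_\nu\cdot 1$ for all $f,g\in V$. Moreover, the following statements are equivalent. 1. The commutator clusters: for all $f,g\in V$, $\displaystyle\lim_{|t|\to\infty}\bigl|{}_\psi\langle 1|[\varphi(f_t),\varphi(g)]|1\rangle_\psi\bigr|=0$. 2. All $2k$-point out-of-time-ordered correlators of the commutator cluster: for all $f,g\in V$ and all integers $k\ge 1$, $\displaystyle\lim_{|t|\to\infty}{}_\psi\langle 1|\,|[\varphi(g),\varphi(f_t)]|^{2k}\,|1\rangle_\psi=0$.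 3. Norm asymptotic Abelianness: for all $f,g\in V$, $\displaystyle\lim_{|t|\to\infty}\|[\varphi(f_t),\varphi(g)]\|_\infty=0$. -/

import Mathlib

open Filter Topology MeasureTheory
open scoped SchwartzMap ComplexOrder ENNReal ComplexConjugate

noncomputable section

namespace GFF

/-! ### States on unital complex `*`-algebras and the GNS construction -/

section GNS

variable {A : Type*} [Ring A] [StarRing A] [Algebra ℂ A] [StarModule ℂ A]

/-- A state on a unital complex `*`-algebra: a normalised positive linear functional. -/
structure AlgState (A : Type*) [Ring A] [StarRing A] [Algebra ℂ A] where
  /-- the underlying linear functional -/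
  toLin : A →ₗ[ℂ] ℂ
  map_one : toLin 1 = 1
  nonneg : ∀ a : A, 0 ≤ toLin (star a * a)

instance : CoeFun (AlgState A) (fun _ => A → ℂ) := ⟨fun ψ => ψ.toLin⟩

/-- Positivity forces the sesquilinear form `(a, b) ↦ ψ (a* b)` to be Hermitian. -/
theorem AlgState.conj_symm (ψ : AlgState A) (a b : A) :
    conj (ψ (star b * a)) = ψ (star a * b) := by
  have ha := (Complex.nonneg_iff.mp (ψ.nonneg a)).2
  have hb := (Complex.nonneg_iff.mp (ψ.nonneg b)).2
  have h1 := (Complex.nonneg_iff.mp (ψ.nonneg (a + b))).2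
  have h2 := (Complex.nonneg_iff.mp (ψ.nonneg (a + Complex.I • b))).2
  simp only [star_add, star_smul, add_mul, mul_add, map_add, smul_mul_assoc, mul_smul_comm,
    map_smul, Complex.add_im, smul_eq_mul, Complex.mul_im, Complex.mul_re, Complex.I_re,
    Complex.I_im, RCLike.star_def, Complex.conj_I, Complex.neg_im, Complex.neg_re] at h1 h2
  apply Complex.ext
  · simp only [Complex.conj_re]
    linarith
  · simp only [Complex.conj_im]
    linarith

/-- The vector space `A`, to be equipped with the semi-inner product `⟨a, b⟩ = ψ (a* b)`. -/
@[nolint unusedArguments]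
def PreGNS (_ψ : AlgState A) : Type _ := A

variable (ψ : AlgState A)

instance : AddCommGroup (PreGNS ψ) := inferInstanceAs (AddCommGroup A)
instance : Module ℂ (PreGNS ψ) := inferInstanceAs (Module ℂ A)

/-- The identity map from the algebra to the pre-GNS space. -/
def toPreGNS : A ≃ₗ[ℂ] PreGNS ψ := LinearEquiv.refl ℂ _

/-- The semi-inner product `⟨a, b⟩ = ψ (a* b)`. -/
abbrev preGNSCore : PreInnerProductSpace.Core ℂ (PreGNS ψ) where
  inner a b := ψ (star ((toPreGNS ψ).symm a) * (toPreGNS ψ).symm b)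
  conj_inner_symm a b := ψ.conj_symm _ _
  re_inner_nonneg a := (Complex.nonneg_iff.mp (ψ.nonneg _)).1
  add_left a b c := by simp [add_mul]
  smul_left a b r := by simp

instance : SeminormedAddCommGroup (PreGNS ψ) :=
  InnerProductSpace.Core.toSeminormedAddCommGroup (c := preGNSCore ψ)
instance : InnerProductSpace ℂ (PreGNS ψ) :=
  InnerProductSpace.ofCore (preGNSCore ψ)

/-- The GNS Hilbert space: null vectors are divided out, and the quotient is completed. -/
abbrev GNSSpace : Type _ := UniformSpace.Completion (PreGNS ψ)

/-- The vector `|a⟩` of the GNS Hilbert space defined by an element `a` of the algebra. -/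
def ket : A →ₗ[ℂ] GNSSpace ψ :=
  (UniformSpace.Completion.toComplₗᵢ (𝕜 := ℂ) (E := PreGNS ψ)).toLinearMap ∘ₗ
    (toPreGNS ψ).toLinearMap

theorem inner_ket (a b : A) : inner ℂ (ket ψ a) (ket ψ b) = ψ (star a * b) :=
  UniformSpace.Completion.inner_coe (𝕜 := ℂ) (toPreGNS ψ a) (toPreGNS ψ b)

/-- The dense subspace `{|a⟩ : a ∈ A}` of the GNS Hilbert space, the common invariant domain of
the (in general unbounded) operators that represent the algebra. -/
def gnsDomain : Submodule ℂ (GNSSpace ψ) := LinearMap.range (ket ψ)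

theorem dense_gnsDomain : Dense (gnsDomain ψ : Set (GNSSpace ψ)) :=
  UniformSpace.Completion.denseRange_coe (α := PreGNS ψ)

/-- The vector `|a⟩`, as an element of the invariant domain. -/
def dket : A →ₗ[ℂ] gnsDomain ψ := (ket ψ).rangeRestrict

theorem coe_dket (a : A) : ((dket ψ a : gnsDomain ψ) : GNSSpace ψ) = ket ψ a := rfl

theorem dket_surjective : Function.Surjective (dket ψ) := (ket ψ).surjective_rangeRestrict

theorem inner_dket (a b : A) : inner ℂ (dket ψ a) (dket ψ b) = ψ (star a * b) :=
  inner_ket ψ a b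

/-- The null vectors form a left ideal. -/
theorem ker_dket_le (a : A) :
    LinearMap.ker (dket ψ) ≤ (LinearMap.ker (dket ψ)).comap (LinearMap.mulLeft ℂ a) := by
  intro b hb
  rw [LinearMap.mem_ker] at hb
  rw [Submodule.mem_comap, LinearMap.mem_ker, LinearMap.mulLeft_apply]
  rw [← inner_self_eq_zero (𝕜 := ℂ), inner_dket]
  have h := inner_dket ψ (star a * (a * b)) b
  rw [hb, inner_zero_right] at h
  rw [h]
  simp only [star_mul, star_star, mul_assoc]

/-- The operator `|b⟩ ↦ |a b⟩` on the invariant domain. -/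
def gnsOp (a : A) : Module.End ℂ (gnsDomain ψ) :=
  (Submodule.liftQ (LinearMap.ker (dket ψ)) (dket ψ ∘ₗ LinearMap.mulLeft ℂ a) (by
      rw [LinearMap.ker_comp]
      exact ker_dket_le ψ a)) ∘ₗ
    ((dket ψ).quotKerEquivOfSurjective (dket_surjective ψ)).symm.toLinearMap

theorem gnsOp_dket (a b : A) : gnsOp ψ a (dket ψ b) = dket ψ (a * b) := by
  have h : ((dket ψ).quotKerEquivOfSurjective (dket_surjective ψ)).symm (dket ψ b) =
      (LinearMap.ker (dket ψ)).mkQ b := by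
    rw [LinearEquiv.symm_apply_eq]
    rfl
  rw [gnsOp, LinearMap.comp_apply, LinearEquiv.coe_coe, h]
  rfl

/-- The GNS representation `a ↦ π(a)`, `π(a) |b⟩ = |a b⟩`, by operators on the invariant domain. -/
def gnsRep : A →ₐ[ℂ] Module.End ℂ (gnsDomain ψ) :=
  AlgHom.ofLinearMap
    { toFun := gnsOp ψ
      map_add' := fun a b => by
        refine LinearMap.ext fun x => ?_
        obtain ⟨c, rfl⟩ := dket_surjective ψ x
        simp only [LinearMap.add_apply, gnsOp_dket, add_mul, map_add]
      map_smul' := fun r a => by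
        refine LinearMap.ext fun x => ?_
        obtain ⟨c, rfl⟩ := dket_surjective ψ x
        simp only [LinearMap.smul_apply, gnsOp_dket, smul_mul_assoc, map_smul, RingHom.id_apply] }
    (by
      refine LinearMap.ext fun x => ?_
      obtain ⟨c, rfl⟩ := dket_surjective ψ x
      simp [gnsOp_dket])
    (fun a b => by
      refine LinearMap.ext fun x => ?_
      obtain ⟨c, rfl⟩ := dket_surjective ψ x
      simp [gnsOp_dket, mul_assoc])

theorem gnsRep_dket (a b : A) : gnsRep ψ a (dket ψ b) = dket ψ (a * b) := gnsOp_dket ψ a b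

/-- On the invariant domain, `π(a*)` is the adjoint of `π(a)`. -/
theorem inner_gnsRep (a : A) (x y : gnsDomain ψ) :
    inner ℂ x (gnsRep ψ a y) = inner ℂ (gnsRep ψ (star a) x) y := by
  obtain ⟨b, rfl⟩ := dket_surjective ψ x
  obtain ⟨c, rfl⟩ := dket_surjective ψ y
  simp only [gnsRep_dket, inner_dket, star_mul, star_star, mul_assoc]

/-- The vector expectation value `⟨1| T |1⟩` in the GNS Hilbert space. -/
def expectation (T : Module.End ℂ (gnsDomain ψ)) : ℂ :=
  inner ℂ (ket ψ 1) (T (dket ψ 1) : GNSSpace ψ)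

/-- The operator norm `sup {‖T x‖ : ‖x‖ ≤ 1}` of a densely defined operator, with the value `∞`
if the operator is unbounded. -/
def opNorm (T : Module.End ℂ (gnsDomain ψ)) : ℝ≥0∞ :=
  ⨆ (x : gnsDomain ψ) (_ : ‖(x : GNSSpace ψ)‖ ≤ 1), ‖(T x : GNSSpace ψ)‖ₑ

end GNS

/-! ### The `*`-algebra of polynomials in field operators -/

/-- The unital complex `*`-algebra of polynomials in noncommuting Hermitian symbols `φ(f)`,
`f ∈ X`. -/
def FieldAlgebra (X : Type*) : Type _ := MonoidAlgebra ℂ (FreeMonoid X)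

namespace FieldAlgebra

variable {X : Type*}

instance : Ring (FieldAlgebra X) := inferInstanceAs (Ring (MonoidAlgebra ℂ (FreeMonoid X)))
instance : Algebra ℂ (FieldAlgebra X) :=
  inferInstanceAs (Algebra ℂ (MonoidAlgebra ℂ (FreeMonoid X)))

/-- The monomial `r φ(f₁) ⋯ φ(fₙ)`. -/
def monomial (m : FreeMonoid X) (r : ℂ) : FieldAlgebra X := MonoidAlgebra.single m r

theorem monomial_mul (m n : FreeMonoid X) (r s : ℂ) :
    monomial m r * monomial n s = monomial (m * n) (r * s) :=
  MonoidAlgebra.single_mul_single ..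

theorem smul_monomial (c : ℂ) (m : FreeMonoid X) (r : ℂ) :
    c • monomial m r = monomial m (c * r) :=
  MonoidAlgebra.smul_single ..

theorem induct {p : FieldAlgebra X → Prop} (a : FieldAlgebra X)
    (h1 : ∀ m r, p (monomial m r)) (h2 : ∀ a b, p a → p b → p (a + b)) : p a := by
  refine MonoidAlgebra.induction_linear (motive := p) a ?_ h2 h1
  have := h1 1 0
  rwa [monomial, MonoidAlgebra.single_zero] at this

/-- The adjoint: words are reversed and coefficients conjugated, so that each symbol `φ(f)` is
Hermitian. -/
def adj : FieldAlgebra X →+ FieldAlgebra X :=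
  (AddMonoidHom.mk' (fun a => MonoidAlgebra.mapDomain (star : FreeMonoid X → FreeMonoid X)
      (MonoidAlgebra.map (starRingEnd ℂ : ℂ →+ ℂ) a))
    (fun a b => by rw [MonoidAlgebra.map_add, MonoidAlgebra.mapDomain_add]) :
    MonoidAlgebra ℂ (FreeMonoid X) →+ MonoidAlgebra ℂ (FreeMonoid X))

theorem adj_monomial (m : FreeMonoid X) (r : ℂ) :
    adj (monomial m r) = monomial (star m) (conj r) := by
  show MonoidAlgebra.mapDomain _ (MonoidAlgebra.map _ (MonoidAlgebra.single m r)) = _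
  rw [MonoidAlgebra.map_single, MonoidAlgebra.mapDomain_single]
  rfl

instance : StarRing (FieldAlgebra X) where
  star := adj
  star_involutive a := by
    induction a using induct with
    | h1 m r => simp [adj_monomial]
    | h2 a b ha hb => rw [map_add, map_add, ha, hb]
  star_mul a b := by
    induction a using induct with
    | h1 m r =>
      induction b using induct with
      | h1 n s => simp only [monomial_mul, adj_monomial, star_mul, map_mul, mul_comm]
      | h2 a b ha hb => rw [mul_add, map_add, ha, hb, map_add, add_mul]
    | h2 a b ha hb => rw [add_mul, map_add, ha, hb, map_add, mul_add]
  star_add a b := map_add adj a b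

theorem star_monomial (m : FreeMonoid X) (r : ℂ) :
    star (monomial m r) = monomial (star m) (conj r) := adj_monomial m r

instance : StarModule ℂ (FieldAlgebra X) where
  star_smul c a := by
    induction a using induct with
    | h1 m r => simp only [smul_monomial, star_monomial, map_mul, RCLike.star_def]
    | h2 a b ha hb => rw [smul_add, star_add, ha, hb, star_add, smul_add]

/-- The field `φ(f)`. -/
def field (f : X) : FieldAlgebra X := monomial (FreeMonoid.of f) 1

theorem star_field (f : X) : star (field f) = field f := by
  simp [field, star_monomial]

/-- The commutator `[φ(f), φ(g)]`. -/
def fieldComm (f g : X) : FieldAlgebra X := field f * field g - field g * field f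

end FieldAlgebra

section Operators

variable {X : Type*} (ψ : AlgState (FieldAlgebra X))

/-- The field operator `φ(f)` in the GNS representation of the state `ψ`. -/
def fieldOp (f : X) : Module.End ℂ (gnsDomain ψ) := gnsRep ψ (FieldAlgebra.field f)

/-- The commutator `[φ(f), φ(g)]` of two field operators in the GNS representation of `ψ`. -/
def commOp (f g : X) : Module.End ℂ (gnsDomain ψ) :=
  fieldOp ψ f * fieldOp ψ g - fieldOp ψ g * fieldOp ψ f

/-- The operator `|[φ(f), φ(g)]|^{2k}`, where `|C|^{2k} = (C† C)^k`. -/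
def commOpPow (f g : X) (k : ℕ) : Module.End ℂ (gnsDomain ψ) :=
  gnsRep ψ ((star (FieldAlgebra.fieldComm f g) * FieldAlgebra.fieldComm f g) ^ k)

theorem commOp_eq (f g : X) : commOp ψ f g = gnsRep ψ (FieldAlgebra.fieldComm f g) := by
  simp only [commOp, fieldOp, FieldAlgebra.fieldComm, map_sub, map_mul]

/-- The adjoint of `[φ(f), φ(g)]` is `[φ(g), φ(f)]`. -/
theorem inner_commOp (f g : X) (x y : gnsDomain ψ) :
    inner ℂ x (commOp ψ f g y) = inner ℂ (commOp ψ g f x) y := by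
  rw [commOp_eq, commOp_eq, inner_gnsRep]
  simp only [FieldAlgebra.fieldComm, star_sub, star_mul, FieldAlgebra.star_field]

end Operators

/-! ### Quasi-free states -/

/-- The `n`-point function given by Wick's theorem: the sum over all pairings of the `n` arguments
of the product of the two-point functions `w` of the pairs, the order inside each pair being that
of the list. The sum is organised by the partner of the first argument, each remaining pairing
being a pairing of the list with these two removed; it is `1` for the empty list and `0` for lists
of odd length. -/
def wick {X : Type*} (w : X → X → ℂ) : List X → ℂ
  | [] => 1
  | f :: l => ∑ i : Fin l.length, w f (l.get i) * wick w (l.eraseIdx i)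
termination_by l => l.length
decreasing_by
  simp only [List.length_cons]
  have := List.length_eraseIdx_le l i
  omega

/-- A state on the polynomials in the fields `φ(f)`, `f ∈ V`, is quasi-free (Gaussian) if its
`n`-point functions `ψ (φ(f₁) ⋯ φ(fₙ))` are given by Wick's theorem, with a two-point function that
is real bilinear in the test functions. -/
def IsQuasiFree {V : Type*} [AddCommGroup V] [Module ℝ V] (ψ : AlgState (FieldAlgebra V)) : Prop :=
  ∃ w : V →ₗ[ℝ] V →ₗ[ℝ] ℂ, ∀ l : List V,
    ψ ((l.map FieldAlgebra.field).prod) = wick (fun f g => w f g) l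

/-! ### Generalized free fields with a given spectral measure -/

/-- The Fourier transform in the frequency, `f̂(ω) = ∫ f(t) e^{iωt} dt`. -/
def freq (f : 𝓢(ℝ, ℂ)) (ω : ℝ) : ℂ := ∫ t : ℝ, Complex.exp (Complex.I * ω * t) * f t

/-- The Hermitian form `⟨f|g⟩ = ∫ conj (f̂(ω)) ĝ(ω) dν(ω)` of the spectral measure `ν`, which is
`Θ(ω) ρ(ω²) dω` in terms of a spectral density `ρ`. -/
def oneParticleForm (ν : Measure ℝ) (f g : 𝓢(ℝ, ℂ)) : ℂ := ∫ ω, conj (freq f ω) * freq g ω ∂ν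

/-- The time-evolved test function `f_t(s) = f(s + t)`. -/
def timeShift (t : ℝ) (f : 𝓢(ℝ, ℂ)) : 𝓢(ℝ, ℂ) := f.compSubConstCLM ℂ (-t)

theorem timeShift_apply (t : ℝ) (f : 𝓢(ℝ, ℂ)) (s : ℝ) : timeShift t f s = f (s + t) := by
  simp [timeShift]

/-- The time-evolved test function in a translation invariant space of test functions. -/
def shift {V : Submodule ℝ 𝓢(ℝ, ℂ)} (hV : ∀ t : ℝ, ∀ f ∈ V, timeShift t f ∈ V) (t : ℝ) (f : V) :
    V := ⟨timeShift t f, hV t f f.2⟩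

/-- The state `ψ` belongs to the generalized free field with spectral measure `ν`: the commutator
function is `ψ ([φ(f), φ(g)]) = 2 i Im ⟨f|g⟩ = ∫ (conj f̂ ĝ - f̂ conj ĝ) dν`. Only this part of the
two-point function is fixed by `ν`; its symmetric part is free. -/
def HasSpectralMeasure (ν : Measure ℝ) {V : Submodule ℝ 𝓢(ℝ, ℂ)}
    (ψ : AlgState (FieldAlgebra V)) : Prop :=
  ∀ f g : V, ψ (FieldAlgebra.fieldComm f g) =
    2 * Complex.I * ((oneParticleForm ν (f : 𝓢(ℝ, ℂ)) (g : 𝓢(ℝ, ℂ))).im : ℂ)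

end GFF

end

/-!
Everything rests on one combinatorial fact (`GFF.wick_swap`): exchanging two adjacent arguments
`f, g` of a function given by Wick's theorem changes it by `w f g - w g f` times the function with
`f` and `g` removed. Indeed, the pairings in which `f` and `g` have different partners are permuted
among themselves by the exchange, and those that pair `f` with `g` contribute the difference.

By linearity a quasi-free state satisfies `ψ (a [φ(f), φ(g)] b) = ψ ([φ(f), φ(g)]) ψ (a b)` for all
polynomials `a, b` (`GFF.IsQuasiFree.map_mul_fieldComm_mul`). These are all the matrix elements of
the commutator between vectors of the GNS domain, so the commutator is the multiple
`c = ψ ([φ(f), φ(g)])` of the identity (`GFF.IsQuasiFree.gnsRep_fieldComm`). Its expectation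
value in `|1⟩` has modulus `|c|`, its operator norm is `|c|`, and `⟨1| |C|^{2k} |1⟩` has
modulus `|c|^{2k}`; hence each of the three cluster properties says that `c` tends to `0` as
`|t| → ∞`.
-/

noncomputable section

namespace GFF

/-! ### Wick's theorem and the exchange of adjacent arguments -/

section Wick

variable {X : Type*}

/-- The sum of `F x r` over the positions in a list, where `x` is the entry at that position and
`r` is the list with this entry removed. -/
def pickSum (F : X → List X → ℂ) (l : List X) : ℂ :=
  ∑ i : Fin l.length, F (l.get i) (l.eraseIdx i)

@[simp]
theorem pickSum_nil (F : X → List X → ℂ) : pickSum F [] = 0 := by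
  simp [pickSum]

@[simp]
theorem pickSum_cons (F : X → List X → ℂ) (a : X) (l : List X) :
    pickSum F (a :: l) = F a l + pickSum (fun x r => F x (a :: r)) l :=
  Fin.sum_univ_succ (n := l.length)
    (fun i => F ((a :: l).get i) ((a :: l).eraseIdx i))

theorem pickSum_congr {F G : X → List X → ℂ} {l : List X}
    (h : ∀ x r, r.length + 1 = l.length → F x r = G x r) : pickSum F l = pickSum G l :=
  Finset.sum_congr rfl fun i _ => h _ _ (List.length_eraseIdx_add_one i.2)

theorem pickSum_add (F G : X → List X → ℂ) (l : List X) :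
    pickSum (fun x r => F x r + G x r) l = pickSum F l + pickSum G l :=
  Finset.sum_add_distrib

theorem mul_pickSum (c : ℂ) (F : X → List X → ℂ) (l : List X) :
    c * pickSum F l = pickSum (fun x r => c * F x r) l :=
  Finset.mul_sum ..

theorem pickSum_append (F : X → List X → ℂ) (l m : List X) :
    pickSum F (l ++ m) =
      pickSum (fun x r => F x (r ++ m)) l + pickSum (fun x r => F x (l ++ r)) m := by
  induction l generalizing F with
  | nil => simp
  | cons a l ih => simp [ih, add_assoc]

/-- Two entries of a list can be removed one after the other in either order. -/
theorem pickSum_comm (G : X → X → List X → ℂ) (l : List X) :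
    pickSum (fun x => pickSum (fun y => G x y)) l =
      pickSum (fun y => pickSum (fun x => G x y)) l := by
  induction l generalizing G with
  | nil => simp
  | cons a l ih =>
    simp only [pickSum_cons, pickSum_add]
    rw [ih fun x y s => G x y (a :: s)]
    ring

theorem wick_cons (w : X → X → ℂ) (f : X) (l : List X) :
    wick w (f :: l) = pickSum (fun x r => w f x * wick w r) l := by
  rw [wick, pickSum]

/-- The exchange relation for the first two arguments: the pairings with `f` and `g` paired to
other arguments form a double sum that is symmetric in `f` and `g`. -/
theorem wick_cons_cons_swap (w : X → X → ℂ) (f g : X) (l : List X) :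
    wick w (f :: g :: l) = wick w (g :: f :: l) + (w f g - w g f) * wick w l := by
  have key := pickSum_comm (fun x y s => w f x * (w g y * wick w s)) l
  have h : pickSum (fun x r => w f x * wick w (g :: r)) l =
      pickSum (fun x r => w g x * wick w (f :: r)) l := by
    simp only [wick_cons, mul_pickSum]
    rw [key]
    simp only [mul_left_comm]
  rw [wick_cons, wick_cons, pickSum_cons, pickSum_cons, h]
  ring

/-- Exchanging two adjacent arguments in Wick's theorem. -/
theorem wick_swap (w : X → X → ℂ) (f g : X) (l m : List X) :
    wick w (l ++ f :: g :: m) =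
      wick w (l ++ g :: f :: m) + (w f g - w g f) * wick w (l ++ m) := by
  induction hn : l.length + m.length using Nat.strong_induction_on generalizing l m with
  | _ n ih =>
    cases l with
    | nil => exact wick_cons_cons_swap w f g m
    | cons h l =>
      simp only [List.length_cons] at hn
      -- The partner of `h` lies in `l`, is `f` or `g`, or lies in `m`; in the first and the last
      -- case the exchange relation for shorter lists applies.
      have h1 : pickSum (fun x r => w h x * wick w (r ++ f :: g :: m)) l =
          pickSum (fun x r => w h x * wick w (r ++ g :: f :: m)) l +
            (w f g - w g f) * pickSum (fun x r => w h x * wick w (r ++ m)) l := by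
        rw [mul_pickSum, ← pickSum_add]
        refine pickSum_congr fun x r hr => ?_
        rw [ih (r.length + m.length) (by omega) r m rfl]
        ring
      have h2 : pickSum (fun x r => w h x * wick w (l ++ f :: g :: r)) m =
          pickSum (fun x r => w h x * wick w (l ++ g :: f :: r)) m +
            (w f g - w g f) * pickSum (fun x r => w h x * wick w (l ++ r)) m := by
        rw [mul_pickSum, ← pickSum_add]
        refine pickSum_congr fun x r hr => ?_
        rw [ih (l.length + r.length) (by omega) l r rfl]
        ring
      simp only [List.cons_append, wick_cons, pickSum_append, pickSum_cons, h1, h2]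
      ring

end Wick

/-! ### The commutator in the GNS representation -/

namespace FieldAlgebra

variable {X : Type*}

theorem prod_map_field (l : List X) :
    (l.map field).prod = monomial (FreeMonoid.ofList l) 1 := by
  induction l with
  | nil => rfl
  | cons f l ih => rw [List.map_cons, List.prod_cons, ih, field, monomial_mul, one_mul]; rfl

theorem monomial_eq_smul_prod (m : FreeMonoid X) (r : ℂ) :
    monomial m r = r • ((FreeMonoid.toList m).map field).prod := by
  rw [prod_map_field, smul_monomial, mul_one, FreeMonoid.ofList_toList]

theorem star_fieldComm (f g : X) : star (fieldComm f g) = fieldComm g f := by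
  simp only [fieldComm, star_sub, star_mul, star_field]

theorem fieldComm_swap (f g : X) : fieldComm g f = -fieldComm f g := by
  simp only [fieldComm, neg_sub]

end FieldAlgebra

section QuasiFree

open FieldAlgebra

variable {V : Type*} [AddCommGroup V] [Module ℝ V] {ψ : AlgState (FieldAlgebra V)}

/-- In the correlation functions of a quasi-free state the field commutator is central, with the
value of its expectation. -/
theorem IsQuasiFree.map_mul_fieldComm_mul (hψ : IsQuasiFree ψ) (f g : V)
    (a b : FieldAlgebra V) : ψ (a * fieldComm f g * b) = ψ (fieldComm f g) * ψ (a * b) := by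
  obtain ⟨w, hw⟩ := hψ
  have key : ∀ l m : List V,
      ψ ((l.map field).prod * fieldComm f g * (m.map field).prod) =
        (w f g - w g f) * ψ ((l.map field).prod * (m.map field).prod) := by
    intro l m
    have e : (l.map field).prod * fieldComm f g * (m.map field).prod =
        ((l ++ f :: g :: m).map field).prod - ((l ++ g :: f :: m).map field).prod := by
      simp only [fieldComm, List.map_append, List.map_cons, List.prod_append, List.prod_cons]
      noncomm_ring
    rw [e, map_sub, hw, hw, ← List.prod_append, ← List.map_append, hw,
      wick_swap (fun f g => w f g) f g l m]
    ring
  have hc : ψ (fieldComm f g) = w f g - w g f := by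
    simpa [ψ.map_one] using key [] []
  rw [hc]
  induction a using induct with
  | h1 p r =>
    induction b using induct with
    | h1 q s =>
      simp only [monomial_eq_smul_prod, smul_mul_assoc, mul_smul_comm, map_smul, key, smul_eq_mul]
      ring
    | h2 b b' hb hb' => simp only [mul_add, map_add, hb, hb']
  | h2 a a' ha ha' => simp only [add_mul, map_add, ha, ha', mul_add]

theorem IsQuasiFree.gnsRep_fieldComm (hψ : IsQuasiFree ψ) (f g : V) :
    gnsRep ψ (fieldComm f g) = ψ (fieldComm f g) • (1 : Module.End ℂ (gnsDomain ψ)) := by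
  refine LinearMap.ext fun x => ext_inner_left ℂ fun y => ?_
  obtain ⟨b, rfl⟩ := dket_surjective ψ x
  obtain ⟨a, rfl⟩ := dket_surjective ψ y
  rw [gnsRep_dket, LinearMap.smul_apply, Module.End.one_apply, inner_smul_right, inner_dket,
    inner_dket, ← mul_assoc, hψ.map_mul_fieldComm_mul]

theorem IsQuasiFree.commOp_eq_smul (hψ : IsQuasiFree ψ) (f g : V) :
    commOp ψ f g = ψ (fieldComm f g) • (1 : Module.End ℂ (gnsDomain ψ)) := by
  rw [commOp_eq, hψ.gnsRep_fieldComm]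

theorem IsQuasiFree.commOpPow_eq_smul (hψ : IsQuasiFree ψ) (f g : V) (k : ℕ) :
    commOpPow ψ g f k =
      (-ψ (fieldComm f g) ^ 2) ^ k • (1 : Module.End ℂ (gnsDomain ψ)) := by
  have h : ψ (fieldComm g f) = -ψ (fieldComm f g) := by rw [fieldComm_swap, map_neg]
  rw [commOpPow, map_pow, map_mul, star_fieldComm, hψ.gnsRep_fieldComm, hψ.gnsRep_fieldComm, h,
    smul_mul_smul_comm, one_mul, smul_pow, one_pow, mul_neg, sq]

end QuasiFree

/-! ### Multiples of the identity on the GNS domain -/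

section Scalar

variable {A : Type*} [Ring A] [StarRing A] [Algebra ℂ A] [StarModule ℂ A] (ψ : AlgState A)

theorem norm_ket_one : ‖ket ψ 1‖ = 1 := by
  rw [norm_eq_sqrt_re_inner (𝕜 := ℂ), inner_ket, star_one, one_mul, ψ.map_one, RCLike.one_re,
    Real.sqrt_one]

theorem expectation_smul_one (c : ℂ) :
    expectation ψ (c • (1 : Module.End ℂ (gnsDomain ψ))) = c := by
  rw [expectation, LinearMap.smul_apply, Module.End.one_apply, Submodule.coe_smul, coe_dket,
    inner_smul_right, inner_ket, star_one, one_mul, ψ.map_one, mul_one]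

theorem opNorm_smul_one (c : ℂ) :
    opNorm ψ (c • (1 : Module.End ℂ (gnsDomain ψ))) = ‖c‖ₑ := by
  refine le_antisymm (iSup₂_le fun x hx => ?_) ?_
  · rw [LinearMap.smul_apply, Module.End.one_apply, Submodule.coe_smul, enorm_smul]
    have hx' : ‖(x : GNSSpace ψ)‖ₑ ≤ 1 := by
      rw [← ofReal_norm]
      exact ENNReal.ofReal_le_one.mpr hx
    exact mul_le_of_le_one_right' hx'
  -- The bound is attained at the unit vector `|1⟩`.
  · have h1 : ‖((dket ψ 1 : gnsDomain ψ) : GNSSpace ψ)‖ = 1 := norm_ket_one ψ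
    refine le_trans (le_of_eq ?_) (le_iSup₂ (dket ψ 1) h1.le)
    rw [LinearMap.smul_apply, Module.End.one_apply, Submodule.coe_smul, enorm_smul,
      ← ofReal_norm (dket ψ 1 : GNSSpace ψ), h1, ENNReal.ofReal_one, mul_one]

end Scalar

end GFF

end

theorem mainTheorem6
    (ν : Measure ℝ) [ν.HasTemperateGrowth] (hν : ν (Set.Iio 0) = 0)
    (V : Submodule ℝ 𝓢(ℝ, ℂ)) (hV : ∀ t : ℝ, ∀ f ∈ V, GFF.timeShift t f ∈ V)
    (ψ : GFF.AlgState (GFF.FieldAlgebra V)) (hψ : GFF.IsQuasiFree ψ)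
    (hψν : GFF.HasSpectralMeasure ν ψ) :
    (∀ f g : V, GFF.commOp ψ f g =
      (2 * Complex.I *
        ((GFF.oneParticleForm ν (f : 𝓢(ℝ, ℂ)) (g : 𝓢(ℝ, ℂ))).im : ℂ)) • (1 : Module.End ℂ (GFF.gnsDomain ψ))) ∧
    List.TFAE [
      ∀ f g : V, Tendsto
        (fun t : ℝ => ‖GFF.expectation ψ
          (GFF.commOp ψ (GFF.shift hV t f) g)‖)
        (comap (fun t : ℝ => |t|) atTop) (𝓝 0),
      ∀ f g : V, ∀ k : ℕ, 1 ≤ k → Tendsto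
        (fun t : ℝ => GFF.expectation ψ
          (GFF.commOpPow ψ g (GFF.shift hV t f) k))
        (comap (fun t : ℝ => |t|) atTop) (𝓝 0),
      ∀ f g : V, Tendsto
        (fun t : ℝ => GFF.opNorm ψ
          (GFF.commOp ψ (GFF.shift hV t f) g))
        (comap (fun t : ℝ => |t|) atTop) (𝓝 0)] := by
  refine ⟨fun f g => by rw [hψ.commOp_eq_smul, hψν], ?_⟩
  simp only [hψ.commOp_eq_smul, hψ.commOpPow_eq_smul, GFF.expectation_smul_one,
    GFF.opNorm_smul_one]
  tfae_have 1 → 2 := fun h f g k hk => by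
    have h2 := (((tendsto_zero_iff_norm_tendsto_zero.mpr (h f g)).pow 2).neg).pow k
    simpa [Nat.one_le_iff_ne_zero.mp hk] using h2
  tfae_have 2 → 1 := fun h f g => by
    have h2 := (h f g 1 le_rfl).norm
    simp only [pow_one, norm_neg, norm_pow, norm_zero] at h2
    simpa using h2.sqrt
  tfae_have 1 ↔ 3 := forall₂_congr fun f g => by
    rw [← tendsto_zero_iff_norm_tendsto_zero, tendsto_zero_iff_enorm_tendsto_zero]
  tfae_finish
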